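/- Fix $d\in\mathbb N$. For $\gamma>0$ let $\varphi_\gamma(x)=e^{-|x|^\gamma}$, $x\in\mathbb R^d$ ($|x|$ the Euclidean norm), and let $\hat g(y)=\int_{\mathbb R^d}g(x)e^{-i(x,y)}\,dx$. Let $\beta>\alpha>0$. (a) The function $\psi=\dfrac{1-\varphi_\beta}{1-\varphi_\alpha}$ (with $\psi(0)=0$, its limit value) belongs to the algebra $W_1(\mathbb R^d)=\{k+\hat g:\ k\in\mathbb C,\ g\in L_1(\mathbb R^d)\}$. (b) For every $\gamma>0$ one has $\widehat{\varphi_\gamma}\in L_1(\mathbb R^d)$, and for all $1\le p\le\infty$, $f\in L_p(\mathbb R^d)$ (complex-valued) and $\varepsilon>0$ the mean $$M_{\gamma,\varepsilon}f(x)=\frac1{(2\pi)^d}\int_{\mathbb R^d}\widehat{\varphi_\gamma}(y)\,f(x-\varepsilon y)\,dy$$ is given by an absolutely convergent integral for almost every $x$ and $M_{\gamma,\varepsilon}f\in L_p(\mathbb R^d)$. (c) There is a constant $c=c(\alpha,\beta)<\infty$ (for the fixed dimension $d$; independent of $p$, $f$ and $\varepsilon$) such that for all $1\le p\le\infty$,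 all $f\in L_p(\mathbb R^d)$ and all $\varepsilon>0$ $$\|f-M_{\beta,\varepsilon}f\|_p\le c\,\|f-M_{\alpha,\varepsilon}f\|_p .$$ -/

import Mathlib

open MeasureTheory
open scoped ENNReal NNReal

noncomputable section

/-- The Fourier transform `ĝ(y) = ∫ e^{-i(x,y)} g(x) dx` on `ℝ^d`
(no `2π` in the exponent, no normalising factor). -/
def fourierHat {d : ℕ} (g : EuclideanSpace ℝ (Fin d) → ℂ) (y : EuclideanSpace ℝ (Fin d)) : ℂ :=
  ∫ x, Complex.exp (-Complex.I * ((inner ℝ x y : ℝ) : ℂ)) * g x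

/-- `φ_α(x) = e^{-|x|^α}`, with `|x|` the Euclidean norm. -/
def gwPhi (d : ℕ) (α : ℝ) (x : EuclideanSpace ℝ (Fin d)) : ℂ :=
  (Real.exp (-(‖x‖ ^ α)) : ℂ)

/-- The mean of `f` generated by `φ_α` with parameter `ε`:
`x ↦ (2π)^{-d} ∫ φ̂_α(y) f(x - ε y) dy`. -/
def gwMean {d : ℕ} (α ε : ℝ) (f : EuclideanSpace ℝ (Fin d) → ℂ)
    (x : EuclideanSpace ℝ (Fin d)) : ℂ :=
  1 / (2 * (Real.pi : ℂ)) ^ d * ∫ y, fourierHat (gwPhi d α) y * f (x - ε • y)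

/-- The algebra `W₀` of Fourier transforms of integrable functions. -/
def wienerZero (d : ℕ) : Set (EuclideanSpace ℝ (Fin d) → ℂ) :=
  {F | ∃ g : EuclideanSpace ℝ (Fin d) → ℂ, Integrable g ∧ F = fourierHat g}

/-- The algebra `W₁` obtained from `W₀` by adjoining the unit: constants plus elements
of `W₀`. -/
def wienerOne (d : ℕ) : Set (EuclideanSpace ℝ (Fin d) → ℂ) :=
  {F | ∃ (k : ℂ), ∃ h ∈ wienerZero d, ∀ x, F x = k + h x}

/-- The quotient `(1 - φ_β) / (1 - φ_α)`. At the origin, where both terms vanish, the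
convention `0 / 0 = 0` gives the limit value `0` of this quotient for `β > α`. -/
def gwRatio (d : ℕ) (α β : ℝ) (x : EuclideanSpace ℝ (Fin d)) : ℂ :=
  (1 - gwPhi d β x) / (1 - gwPhi d α x)

end

/-! The quotient and each `φ_γ` have the form `H(|x|²)`, where `H` is built from `exp(-z^a)` with
exponents half the original ones. Such an `H` is holomorphic on a narrow cone around the positive
half-line and tends, at power rates, to `H 0` at the origin and to a constant `k` at infinity
(`IsConicSymbol`). Cauchy's estimates on discs of radius `c s` make `s^n H^(n+1)(s)` integrable on
`(0, ∞)`, and Taylor's formula based at infinity gives `H(u) - k = A ∫ (1 - u/s)₊^n s^n H^(n+1)(s)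
ds`.

With `u = |x|²` and `n = d + 2` this is an `L¹` superposition of dilates of the kernel `(1 -
|x|²)₊^(d+2)`. That kernel is `C^(d+1)` with compact support, hence in `W₀`; dilation preserves the
`L¹` norm of the function whose transform it is, so by Fubini the superposition is in `W₀` too
(`radial_mem_wienerZero`). This gives (a), and also `φ_γ ∈ W₀`. As `φ_γ` is integrable as well,
inversion makes its transform integrable, and (b) follows from Young's inequality.

For (c), the means are convolutions with kernels `A`, `B` whose symbols satisfy `1 - B̂ = (1 + ĝ)(1
- Â)`. Uniqueness of the transform gives `B + g = A + g ⋆ A`, so with `u = f - A ⋆ f` one has `f - B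
⋆ f = u + g ⋆ u`, and Young's inequality yields the constant `1 + ‖g‖₁`
(`eLpNorm_sub_convolution_le`). -/

open scoped Convolution

/-! ### Normalisation, inversion, uniqueness and dilation for `fourierHat`. -/

open scoped FourierTransform in
theorem fourierHat_eq_fourier {d : ℕ} (g : EuclideanSpace ℝ (Fin d) → ℂ)
    (y : EuclideanSpace ℝ (Fin d)) : fourierHat g y = 𝓕 g ((2 * Real.pi)⁻¹ • y) := by
  rw [Real.fourier_eq']
  unfold fourierHat
  refine integral_congr_ae (Filter.Eventually.of_forall fun x => ?_)
  simp only [real_inner_smul_right, smul_eq_mul]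
  congr 2
  push_cast
  field_simp

open scoped FourierTransform in
theorem fourier_eq_fourierHat {d : ℕ} (g : EuclideanSpace ℝ (Fin d) → ℂ)
    (y : EuclideanSpace ℝ (Fin d)) : 𝓕 g y = fourierHat g ((2 * Real.pi) • y) := by
  rw [fourierHat_eq_fourier, smul_smul, inv_mul_cancel₀ (by positivity), one_smul]

open scoped FourierTransform ContDiff SchwartzMap in
/-- Fourier inversion for integrable functions with integrable Fourier transform, almost
everywhere. -/
theorem fourierInv_fourier_ae_eq {V : Type*} [NormedAddCommGroup V] [InnerProductSpace ℝ V]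
    [FiniteDimensional ℝ V] [MeasurableSpace V] [BorelSpace V] {g : V → ℂ}
    (hg : Integrable g) (hg' : Integrable (𝓕 g)) : 𝓕⁻ (𝓕 g) =ᵐ[volume] g := by
  have hcont : Continuous (𝓕⁻ (𝓕 g)) := by
    have := VectorFourier.fourierIntegral_continuous (μ := (volume : Measure V))
      (L := innerₗ V) Real.continuous_fourierChar continuous_inner hg'
    have h2 : 𝓕⁻ (𝓕 g) = fun x => 𝓕 (𝓕 g) (-x) := by
      ext x; rw [Real.fourierInv_eq_fourier_neg]
    rw [h2]
    exact this.comp continuous_neg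
  -- Test against a smooth compactly supported `η`, written as `𝓕 (𝓕⁻ S)` with `S` Schwartz; moving
  -- the transform across the pairing twice reduces the claim to inversion for `S`.
  refine ae_eq_of_integral_contDiff_smul_eq hcont.locallyIntegrable hg.locallyIntegrable ?_
  intro η hη hηc
  have hηC : ContDiff ℝ ∞ (fun x => (η x : ℂ)) := Complex.ofRealCLM.contDiff.comp hη
  have hηcC : HasCompactSupport (fun x => (η x : ℂ)) := hηc.comp_left Complex.ofReal_zero
  let S : 𝓢(V, ℂ) := hηcC.toSchwartzMap hηC
  have hS : ∀ x, S x = (η x : ℂ) := fun x => rfl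
  have key : ∀ {f h : V → ℂ}, Integrable f → Integrable h →
      ∫ ξ, 𝓕 f ξ * h ξ = ∫ x, f x * 𝓕 h x := by
    intro f h hf hh
    simpa using! VectorFourier.integral_fourierIntegral_smul_eq_flip (L := innerₗ V)
      Real.continuous_fourierChar continuous_inner hf hh
  have hSinv : ∀ x, 𝓕 (𝓕⁻ S) x = (η x : ℂ) := by
    intro x
    rw [FourierTransform.fourier_fourierInv_eq]; exact hS x
  simp only [Complex.real_smul]
  have e1 : ∫ x, (η x : ℂ) * 𝓕⁻ (𝓕 g) x = ∫ x, 𝓕 g x * 𝓕⁻ S x := by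
    have := key (f := 𝓕 g) (h := fun x => S (-x)) hg' S.integrable.comp_neg
    rw [← integral_neg_eq_self]
    have h2 : ∀ x, 𝓕 (fun x => S (-x)) x = 𝓕⁻ S x := by
      intro x
      rw [SchwartzMap.fourierInv_coe, Real.fourierInv_eq_fourier_comp_neg]
    simp only [h2] at this
    rw [← this]
    refine integral_congr_ae (Filter.Eventually.of_forall fun x => ?_)
    simp [hS, Real.fourierInv_eq_fourier_neg, mul_comm]
  rw [e1, key hg (𝓕⁻ S).integrable]
  refine integral_congr_ae (Filter.Eventually.of_forall fun x => ?_)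
  simp only
  rw [← SchwartzMap.fourier_coe, hSinv, mul_comm]

-- The difference has zero transform, which is trivially integrable, so the inversion theorem
-- applies to it.
open scoped FourierTransform in
theorem ae_eq_of_fourierHat_eq {d : ℕ} {g h : EuclideanSpace ℝ (Fin d) → ℂ}
    (hg : Integrable g) (hh : Integrable h) (H : ∀ y, fourierHat g y = fourierHat h y) :
    g =ᵐ[volume] h := by
  have hz : 𝓕 (g - h) = 0 := by
    ext y
    have h1 : 𝓕 (g - h) y = 𝓕 g y - 𝓕 h y := by
      simp only [Real.fourier_eq, Pi.sub_apply, smul_sub]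
      exact integral_sub ((Real.fourierIntegral_convergent_iff y).2 hg)
        ((Real.fourierIntegral_convergent_iff y).2 hh)
    rw [h1, fourier_eq_fourierHat, fourier_eq_fourierHat, H, sub_self]; rfl
  have h2 := fourierInv_fourier_ae_eq (hg.sub hh) (by rw [hz]; exact integrable_zero _ _ _)
  rw [hz] at h2
  filter_upwards [h2] with x hx
  have : (𝓕⁻ (0 : EuclideanSpace ℝ (Fin d) → ℂ)) x = 0 := by
    simp [Real.fourierInv_eq]
  rw [this, Pi.sub_apply] at hx
  exact (sub_eq_zero.1 hx.symm)

theorem fourierHat_dilate {d : ℕ} (g : EuclideanSpace ℝ (Fin d) → ℂ) {ε : ℝ} (hε : 0 < ε)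
    (y : EuclideanSpace ℝ (Fin d)) :
    fourierHat (fun x => ((ε ^ d)⁻¹ : ℝ) * g (ε⁻¹ • x)) y = fourierHat g (ε • y) := by
  unfold fourierHat
  have := Measure.integral_comp_smul (volume : Measure (EuclideanSpace ℝ (Fin d)))
    (fun x => Complex.exp (-Complex.I * ((inner ℝ x (ε • y) : ℝ) : ℂ)) * g x) ε⁻¹
  simp only [finrank_euclideanSpace, Fintype.card_fin] at this
  have h2 : |((ε⁻¹) ^ d)⁻¹| = ε ^ d := by
    rw [inv_pow, inv_inv, abs_of_pos (by positivity)]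
  rw [h2] at this
  refine smul_right_injective ℂ (pow_pos hε d).ne' ?_
  simp only
  rw [← this, ← integral_smul]
  refine integral_congr_ae (Filter.Eventually.of_forall fun x => ?_)
  have hd : (ε : ℂ) ^ d ≠ 0 := by exact_mod_cast (pow_pos hε d).ne'
  have hin : inner ℝ (ε⁻¹ • x) (ε • y) = inner ℝ x y := by
    rw [real_inner_smul_left, real_inner_smul_right, inv_mul_cancel_left₀ hε.ne']
  simp only [hin, Complex.real_smul]
  push_cast
  field_simp

theorem integrable_dilate {d : ℕ} {g : EuclideanSpace ℝ (Fin d) → ℂ} (hg : Integrable g) {ε : ℝ}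
    (hε : 0 < ε) :
    Integrable (fun x : EuclideanSpace ℝ (Fin d) => (((ε ^ d)⁻¹ : ℝ) : ℂ) * g (ε⁻¹ • x)) :=
  (hg.comp_smul (inv_ne_zero hε.ne')).const_mul _

theorem integral_norm_dilate {d : ℕ} (g : EuclideanSpace ℝ (Fin d) → ℂ) {ε : ℝ}
    (hε : 0 < ε) :
    ∫ x : EuclideanSpace ℝ (Fin d), ‖(((ε ^ d)⁻¹ : ℝ) : ℂ) * g (ε⁻¹ • x)‖ = ∫ x, ‖g x‖ := by
  have := Measure.integral_comp_smul (volume : Measure (EuclideanSpace ℝ (Fin d)))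
    (fun x => ‖g x‖) ε⁻¹
  simp only [finrank_euclideanSpace, Fintype.card_fin] at this
  have h2 : |((ε⁻¹) ^ d)⁻¹| = ε ^ d := by
    rw [inv_pow, inv_inv, abs_of_pos (by positivity)]
  rw [h2] at this
  simp only [norm_mul]
  rw [integral_const_mul, this, Complex.norm_real, Real.norm_of_nonneg (by positivity), smul_eq_mul,
    inv_mul_cancel_left₀ (by positivity)]

open scoped FourierTransform in
/-- An integrable Fourier transform of an integrable function has an integrable Fourier
transform, and the inversion formula holds. -/
theorem fourierHat_inversion {d : ℕ} {g : EuclideanSpace ℝ (Fin d) → ℂ} (hg : Integrable g)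
    (hg' : Integrable (fourierHat g)) :
    Integrable (fourierHat (fourierHat g)) ∧
      (fun y => 1 / (2 * (Real.pi : ℂ)) ^ d * fourierHat (fourierHat g) y)
        =ᵐ[volume] fun y => g (-y) := by
  have hF : 𝓕 g = fun y => fourierHat g ((2 * Real.pi) • y) := funext (fourier_eq_fourierHat g)
  have hFi : Integrable (𝓕 g) := by
    rw [hF]; exact hg'.comp_smul (by positivity)
  have h1 := fourierInv_fourier_ae_eq hg hFi
  have h2 : ∀ y, 𝓕⁻ (𝓕 g) (-y) = 1 / (2 * (Real.pi : ℂ)) ^ d * fourierHat (fourierHat g) y := by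
    intro y
    rw [Real.fourierInv_eq_fourier_neg, neg_neg, fourier_eq_fourierHat, hF]
    have := fourierHat_dilate (fourierHat g) (ε := (2 * Real.pi)⁻¹) (by positivity)
      ((2 * Real.pi) • y)
    rw [smul_smul, inv_mul_cancel₀ (by positivity), one_smul] at this
    rw [← this]
    simp only [inv_inv, inv_pow]
    unfold fourierHat
    rw [← integral_const_mul]
    refine integral_congr_ae (Filter.Eventually.of_forall fun x => ?_)
    have hd : (2 * (Real.pi : ℂ)) ^ d ≠ 0 := by
      exact_mod_cast (pow_pos Real.two_pi_pos d).ne'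
    simp only
    push_cast
    field_simp
  have h3 : (fun y => 1 / (2 * (Real.pi : ℂ)) ^ d * fourierHat (fourierHat g) y)
      =ᵐ[volume] fun y => g (-y) := by
    have := (Measure.measurePreserving_neg
      (volume : Measure (EuclideanSpace ℝ (Fin d)))).quasiMeasurePreserving.ae_eq_comp h1
    filter_upwards [this] with y hy
    rw [← h2]; exact hy
  refine ⟨?_, h3⟩
  -- Integrability of the double transform is read off from its a.e. identification with the
  -- reflection of `g`.
  have h4 : Integrable (fun y => 1 / (2 * (Real.pi : ℂ)) ^ d * fourierHat (fourierHat g) y) :=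
    (integrable_congr h3).2 hg.comp_neg
  have h5 := h4.const_mul ((2 * (Real.pi : ℂ)) ^ d)
  refine h5.congr (Filter.Eventually.of_forall fun x => ?_)
  have hd : (2 * (Real.pi : ℂ)) ^ d ≠ 0 := by
    exact_mod_cast (pow_pos Real.two_pi_pos d).ne'
  simp only
  field_simp

/-! ### Young's inequality, existence and associativity of convolutions on `L^p`. -/

/-- Jensen's inequality for a weighted lower integral. -/
theorem lintegral_mul_rpow_le {X : Type*} [MeasurableSpace X] (μ : Measure X) {k F : X → ℝ≥0∞}
    (hk : AEMeasurable k μ) (hF : AEMeasurable F μ) {p : ℝ} (hp : 1 ≤ p) :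
    (∫⁻ y, k y * F y ∂μ) ^ p ≤ (∫⁻ y, k y ∂μ) ^ (p - 1) * ∫⁻ y, k y * F y ^ p ∂μ := by
  rcases hp.eq_or_lt with rfl | hp
  · simp
  have hpq := Real.HolderConjugate.conjExponent hp
  set q := Real.conjExponent p
  have hp0 : 0 < p := hpq.pos
  -- Hölder applied to the splitting `k F = (k^(1/p) F) · k^(1/q)`.
  have h := ENNReal.lintegral_mul_le_Lp_mul_Lq μ hpq (f := fun y => k y ^ (1 / p) * F y)
    (g := fun y => k y ^ (1 / q)) ((hk.pow_const _).mul hF) (hk.pow_const _)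
  have e1 : ∀ y, ((fun y => k y ^ (1 / p) * F y) * fun y => k y ^ (1 / q)) y = k y * F y := by
    intro y
    have : k y ^ (1 / p) * k y ^ (1 / q) = k y := by
      rw [← ENNReal.rpow_add_of_nonneg _ _ (by positivity) hpq.symm.one_div_nonneg]
      simp [hpq.inv_add_inv_eq_one]
    simp only [Pi.mul_apply]
    rw [mul_right_comm, this]
  have e2 : ∀ y, (k y ^ (1 / p) * F y) ^ p = k y * F y ^ p := by
    intro y
    rw [ENNReal.mul_rpow_of_nonneg _ _ hp0.le, ← ENNReal.rpow_mul, one_div_mul_cancel hp0.ne',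
      ENNReal.rpow_one]
  have e3 : ∀ y, (k y ^ (1 / q)) ^ q = k y := by
    intro y
    rw [← ENNReal.rpow_mul, one_div_mul_cancel hpq.symm.pos.ne', ENNReal.rpow_one]
  simp only [e1, e2, e3] at h
  calc _ ≤ ((∫⁻ y, k y * F y ^ p ∂μ) ^ (1 / p) * (∫⁻ y, k y ∂μ) ^ (1 / q)) ^ p :=
        ENNReal.rpow_le_rpow h hp0.le
    _ = _ := by
        rw [ENNReal.mul_rpow_of_nonneg _ _ hp0.le, ← ENNReal.rpow_mul, one_div_mul_cancel hp0.ne',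
          ENNReal.rpow_one, ← ENNReal.rpow_mul, mul_comm]
        congr 2
        rw [one_div, inv_mul_eq_div]
        exact hpq.div_conj_eq_sub_one

section Young

variable {V : Type*} [NormedAddCommGroup V] [InnerProductSpace ℝ V]
    [FiniteDimensional ℝ V] [MeasurableSpace V] [BorelSpace V] {𝕜 : Type*} [RCLike 𝕜]

/-- Working with the integral of norms serves both Young's inequality and a.e. absolute convergence.
For finite `p`: Jensen with weight `‖g‖`, then Tonelli and translation invariance. -/
theorem eLpNorm_lintegral_convolution_le {g f : V → 𝕜} (hg : AEStronglyMeasurable g volume)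
    (hf : AEStronglyMeasurable f volume) {p : ℝ≥0∞} (hp : 1 ≤ p) :
    eLpNorm (fun x => ∫⁻ y, ‖g y‖ₑ * ‖f (x - y)‖ₑ) p volume ≤
      eLpNorm g 1 volume * eLpNorm f p volume := by
  rw [eLpNorm_one_eq_lintegral_enorm]
  rcases eq_or_ne p ⊤ with rfl | hpt
  · simp only [eLpNorm_exponent_top]
    refine eLpNormEssSup_le_of_ae_enorm_bound (Filter.Eventually.of_forall fun x => ?_)
    rw [enorm_eq_self]
    have h1 : ∀ᵐ y, ‖f (x - y)‖ₑ ≤ eLpNormEssSup f volume :=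
      (quasiMeasurePreserving_sub_left_of_right_invariant volume x).ae
        (ae_le_eLpNormEssSup (f := f))
    rw [← lintegral_mul_const'' _ hg.enorm]
    refine lintegral_mono_ae ?_
    filter_upwards [h1] with y hy
    gcongr
  · have hp0 : p ≠ 0 := (zero_lt_one.trans_le hp).ne'
    have hr : 1 ≤ p.toReal := by
      rw [← ENNReal.toReal_one]; exact ENNReal.toReal_mono hpt hp
    have hr0 : 0 < p.toReal := zero_lt_one.trans_le hr
    rw [eLpNorm_eq_lintegral_rpow_enorm_toReal hp0 hpt,
      eLpNorm_eq_lintegral_rpow_enorm_toReal hp0 hpt]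
    simp only [enorm_eq_self]
    set r := p.toReal
    have hm : AEMeasurable (fun q : V × V => ‖g q.2‖ₑ * ‖f (q.1 - q.2)‖ₑ ^ r)
        (volume.prod volume) := by
      refine (hg.comp_snd.enorm).mul ((AEStronglyMeasurable.enorm ?_).pow_const _)
      exact (hf.mono_ac (quasiMeasurePreserving_sub_of_right_invariant
        volume volume).absolutelyContinuous).comp_measurable measurable_sub
    have h1 : ∫⁻ x, (∫⁻ y, ‖g y‖ₑ * ‖f (x - y)‖ₑ) ^ r ≤
        (∫⁻ y, ‖g y‖ₑ) ^ r * ∫⁻ x, ‖f x‖ₑ ^ r := by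
      calc _ ≤ ∫⁻ x, (∫⁻ y, ‖g y‖ₑ) ^ (r - 1) * ∫⁻ y, ‖g y‖ₑ * ‖f (x - y)‖ₑ ^ r := by
            refine lintegral_mono fun x => lintegral_mul_rpow_le volume hg.enorm ?_ hr
            exact (hf.comp_quasiMeasurePreserving
              (quasiMeasurePreserving_sub_left_of_right_invariant volume x)).enorm
        _ = (∫⁻ y, ‖g y‖ₑ) ^ (r - 1) * ∫⁻ x, ∫⁻ y, ‖g y‖ₑ * ‖f (x - y)‖ₑ ^ r :=
            lintegral_const_mul'' _ hm.lintegral_prod_right'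
        _ = (∫⁻ y, ‖g y‖ₑ) ^ (r - 1) * ∫⁻ y, ∫⁻ x, ‖g y‖ₑ * ‖f (x - y)‖ₑ ^ r := by
            rw [lintegral_lintegral_swap hm]
        _ = (∫⁻ y, ‖g y‖ₑ) ^ (r - 1) * ((∫⁻ y, ‖g y‖ₑ) * ∫⁻ x, ‖f x‖ₑ ^ r) := by
            congr 1
            rw [← lintegral_mul_const'' _ hg.enorm]
            refine lintegral_congr fun y => ?_
            have hfm : AEMeasurable (fun x => ‖f (x - y)‖ₑ ^ r) volume :=
              ((hf.comp_quasiMeasurePreserving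
                (measurePreserving_sub_right volume y).quasiMeasurePreserving).enorm).pow_const _
            rw [lintegral_const_mul'' _ hfm,
              lintegral_sub_right_eq_self (fun x => ‖f x‖ₑ ^ r)]
        _ = _ := by
            rw [← mul_assoc]
            congr 1
            nth_rw 2 [← ENNReal.rpow_one (∫⁻ y, ‖g y‖ₑ)]
            rw [← ENNReal.rpow_add_of_nonneg _ _ (by linarith) zero_le_one, sub_add_cancel]
    calc _ ≤ ((∫⁻ y, ‖g y‖ₑ) ^ r * ∫⁻ x, ‖f x‖ₑ ^ r) ^ (1 / r) :=
          ENNReal.rpow_le_rpow h1 (by positivity)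
      _ = _ := by
          rw [ENNReal.mul_rpow_of_nonneg _ _ (by positivity), ← ENNReal.rpow_mul,
            mul_one_div_cancel hr0.ne', ENNReal.rpow_one]

theorem aestronglyMeasurable_convolution_mul {g f : V → 𝕜} (hg : AEStronglyMeasurable g volume)
    (hf : AEStronglyMeasurable f volume) :
    AEStronglyMeasurable (g ⋆[ContinuousLinearMap.mul 𝕜 𝕜, volume] f) volume :=
  (hg.convolution_integrand (ContinuousLinearMap.mul 𝕜 𝕜) hf).integral_prod_right'

/-- Young's inequality for the convolution of an integrable function with an `L^p` function. -/
theorem eLpNorm_convolution_le {g f : V → 𝕜} (hg : AEStronglyMeasurable g volume)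
    (hf : AEStronglyMeasurable f volume) {p : ℝ≥0∞} (hp : 1 ≤ p) :
    eLpNorm (g ⋆[ContinuousLinearMap.mul 𝕜 𝕜, volume] f) p volume ≤
      eLpNorm g 1 volume * eLpNorm f p volume := by
  refine le_trans (eLpNorm_mono_enorm fun x => ?_) (eLpNorm_lintegral_convolution_le hg hf hp)
  rw [enorm_eq_self]
  refine (enorm_integral_le_lintegral_enorm _).trans (le_of_eq ?_)
  simp [enorm_mul]

theorem MeasureTheory.MemLp.convolution_of_integrable {g f : V → 𝕜} (hg : Integrable g)
    {p : ℝ≥0∞} (hp : 1 ≤ p) (hf : MemLp f p volume) :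
    MemLp (g ⋆[ContinuousLinearMap.mul 𝕜 𝕜, volume] f) p volume :=
  ⟨aestronglyMeasurable_convolution_mul hg.1 hf.1,
    (eLpNorm_convolution_le hg.1 hf.1 hp).trans_lt
      (ENNReal.mul_lt_top (memLp_one_iff_integrable.2 hg).2 hf.2)⟩

theorem ae_convolutionExistsAt_of_memLp {g f : V → 𝕜} (hg : Integrable g)
    {p : ℝ≥0∞} (hp : 1 ≤ p) (hf : MemLp f p volume) :
    ∀ᵐ x, ConvolutionExistsAt g f x (ContinuousLinearMap.mul 𝕜 𝕜) volume := by
  have h1 : eLpNorm (fun x => ∫⁻ y, ‖g y‖ₑ * ‖f (x - y)‖ₑ) p volume < ⊤ :=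
    (eLpNorm_lintegral_convolution_le hg.1 hf.1 hp).trans_lt
      (ENNReal.mul_lt_top (memLp_one_iff_integrable.2 hg).2 hf.2)
  have hm : AEMeasurable (fun q : V × V => ‖g q.2‖ₑ * ‖f (q.1 - q.2)‖ₑ)
      (volume.prod volume) := by
    refine (hg.1.comp_snd.enorm).mul (AEStronglyMeasurable.enorm ?_)
    exact (hf.1.mono_ac (quasiMeasurePreserving_sub_of_right_invariant
      volume volume).absolutelyContinuous).comp_measurable measurable_sub
  have h2 : ∀ᵐ x, (∫⁻ y, ‖g y‖ₑ * ‖f (x - y)‖ₑ) < ⊤ := by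
    rcases eq_or_ne p ⊤ with rfl | hpt
    · rw [eLpNorm_exponent_top] at h1
      filter_upwards [ae_le_eLpNormEssSup (f := fun x => ∫⁻ y, ‖g y‖ₑ * ‖f (x - y)‖ₑ)
        (μ := volume)] with x hx
      exact (hx.trans_lt h1)
    · have hp0 : p ≠ 0 := (zero_lt_one.trans_le hp).ne'
      have hr0 : 0 < p.toReal := ENNReal.toReal_pos hp0 hpt
      have h3 := lintegral_rpow_enorm_lt_top_of_eLpNorm_lt_top hp0 hpt h1
      simp only [enorm_eq_self] at h3
      filter_upwards [ae_lt_top' (hm.lintegral_prod_right'.pow_const _) h3.ne] with x hx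
      exact (ENNReal.rpow_lt_top_iff_of_pos hr0).1 hx
  filter_upwards [h2] with x hx
  refine ⟨?_, ?_⟩
  · exact hg.1.convolution_integrand_snd (ContinuousLinearMap.mul 𝕜 𝕜) hf.1 x
  · rw [hasFiniteIntegral_iff_enorm]
    simpa [enorm_mul] using hx

/-- Fubini needs the triple integral to converge absolutely at `x`; this is the existence result
applied to the real functions `‖g‖` and `‖h‖ ⋆ ‖f‖`. -/
theorem convolution_assoc_of_memLp {g h f : V → 𝕜} (hg : Integrable g) (hh : Integrable h)
    {p : ℝ≥0∞} (hp : 1 ≤ p) (hf : MemLp f p volume) :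
    ∀ᵐ x, ((g ⋆[ContinuousLinearMap.mul 𝕜 𝕜, volume] h) ⋆[ContinuousLinearMap.mul 𝕜 𝕜, volume] f) x
      = (g ⋆[ContinuousLinearMap.mul 𝕜 𝕜, volume]
          (h ⋆[ContinuousLinearMap.mul 𝕜 𝕜, volume] f)) x := by
  have h1 : ∀ᵐ x, ConvolutionExistsAt (fun x => ‖g x‖)
      ((fun x => ‖h x‖) ⋆[ContinuousLinearMap.mul ℝ ℝ, volume] fun x => ‖f x‖) x
      (ContinuousLinearMap.mul ℝ ℝ) volume :=
    ae_convolutionExistsAt_of_memLp hg.norm hp (hf.norm.convolution_of_integrable hh.norm hp)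
  filter_upwards [h1] with x hx
  exact convolution_assoc _ _ _ _ (fun a b c => mul_assoc a b c) hg.1 hh.1 hf.1
    (hg.ae_convolution_exists _ hh) (ae_convolutionExistsAt_of_memLp hh.norm hp hf.norm) hx

end Young

/-! ### Symbols of convolution operators and the comparison principle. -/

open scoped FourierTransform

theorem fourierHat_convolution {d : ℕ} {g h : EuclideanSpace ℝ (Fin d) → ℂ}
    (hg : Integrable g) (hh : Integrable h) (y : EuclideanSpace ℝ (Fin d)) :
    fourierHat (g ⋆[ContinuousLinearMap.mul ℂ ℂ, volume] h) y =
      fourierHat g y * fourierHat h y := by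
  simp only [fourierHat_eq_fourier]
  exact Real.fourier_mul_convolution_eq hg hh _

theorem integrable_exp_inner_mul {d : ℕ} {g : EuclideanSpace ℝ (Fin d) → ℂ} (hg : Integrable g)
    (y : EuclideanSpace ℝ (Fin d)) :
    Integrable fun x => Complex.exp (-Complex.I * ((inner ℝ x y : ℝ) : ℂ)) * g x := by
  refine hg.bdd_mul (c := 1) (by fun_prop) (Filter.Eventually.of_forall fun x => ?_)
  rw [Complex.norm_exp]
  simp

theorem fourierHat_add {d : ℕ} {g h : EuclideanSpace ℝ (Fin d) → ℂ}
    (hg : Integrable g) (hh : Integrable h) (y : EuclideanSpace ℝ (Fin d)) :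
    fourierHat (fun x => g x + h x) y = fourierHat g y + fourierHat h y := by
  unfold fourierHat
  rw [← integral_add (integrable_exp_inner_mul hg y) (integrable_exp_inner_mul hh y)]
  simp only [mul_add]

/-- Comparison of two convolution operators on `L^p`, when one symbol divides the other in the
algebra of Fourier transforms with unit adjoined. -/
theorem eLpNorm_sub_convolution_le {d : ℕ} {A B g : EuclideanSpace ℝ (Fin d) → ℂ}
    (hA : Integrable A) (hB : Integrable B) (hg : Integrable g)
    (H : ∀ y, 1 - fourierHat B y = (1 + fourierHat g y) * (1 - fourierHat A y))
    {p : ℝ≥0∞} (hp : 1 ≤ p) {f : EuclideanSpace ℝ (Fin d) → ℂ} (hf : MemLp f p volume) :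
    eLpNorm (fun x => f x - (B ⋆[ContinuousLinearMap.mul ℂ ℂ, volume] f) x) p volume ≤
      (1 + eLpNorm g 1 volume) *
        eLpNorm (fun x => f x - (A ⋆[ContinuousLinearMap.mul ℂ ℂ, volume] f) x) p volume := by
  set m := ContinuousLinearMap.mul ℂ ℂ
  have hgA : Integrable (g ⋆[m, volume] A) := hg.integrable_convolution m hA
  -- The identity of symbols, expanded, becomes an a.e. identity of kernels.
  have hAg : (fun x => B x + g x) =ᵐ[volume] fun x => A x + (g ⋆[m, volume] A) x := by
    refine ae_eq_of_fourierHat_eq (hB.add hg) (hA.add hgA) fun y => ?_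
    rw [fourierHat_add hB hg, fourierHat_add hA hgA, fourierHat_convolution hg hA]
    linear_combination -H y
  have hcongr : (fun x => B x + g x) ⋆[m, volume] f
      = (fun x => A x + (g ⋆[m, volume] A) x) ⋆[m, volume] f :=
    convolution_congr m hAg (Filter.EventuallyEq.refl _ _)
  set u : EuclideanSpace ℝ (Fin d) → ℂ := fun x => f x - (A ⋆[m, volume] f) x with hu
  have hAf : MemLp (A ⋆[m, volume] f) p volume := hf.convolution_of_integrable hA hp
  have hup : MemLp u p volume := hf.sub hAf
  -- Convolving the kernel identity with `f` and using associativity; the a.e. existence facts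
  -- justify splitting each convolution.
  have key : (fun x => f x - (B ⋆[m, volume] f) x) =ᵐ[volume]
      u + (g ⋆[m, volume] u) := by
    filter_upwards [ae_convolutionExistsAt_of_memLp hB hp hf,
      ae_convolutionExistsAt_of_memLp hA hp hf, ae_convolutionExistsAt_of_memLp hg hp hf,
      ae_convolutionExistsAt_of_memLp hgA hp hf, ae_convolutionExistsAt_of_memLp hg hp hAf,
      convolution_assoc_of_memLp hg hA hp hf] with x e1 e2 e3 e4 e5 e6
    have c := congrFun hcongr x
    have c1 : ((fun x => B x + g x) ⋆[m, volume] f) x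
      = (B ⋆[m, volume] f) x + (g ⋆[m, volume] f) x := e1.add_distrib e3
    have c2 : ((fun x => A x + (g ⋆[m, volume] A) x) ⋆[m, volume] f) x
      = (A ⋆[m, volume] f) x + ((g ⋆[m, volume] A) ⋆[m, volume] f) x := e2.add_distrib e4
    have c3 : (g ⋆[m, volume] u) x
        = (g ⋆[m, volume] f) x - (g ⋆[m, volume] (A ⋆[m, volume] f)) x := by
      refine Eq.trans ?_ (integral_sub e3 e5)
      rw [convolution_def]
      refine integral_congr_ae (Filter.Eventually.of_forall fun t => ?_)
      simp [hu, m, mul_sub, convolution_def]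
    rw [c1, c2, e6] at c
    rw [Pi.add_apply, c3]
    simp only [hu]
    linear_combination -c
  rw [eLpNorm_congr_ae key]
  refine (eLpNorm_add_le hup.1 (hup.convolution_of_integrable hg hp).1 hp).trans ?_
  rw [add_mul, one_mul]
  gcongr
  exact eLpNorm_convolution_le hg.1 hup.1 hp

/-! ### Truncated powers and Riesz kernels. -/

/-- Only `t = 0` needs care: there the function is `O(|t|^(n+2))` with exponent above one, so its
derivative is zero. -/
theorem hasDerivAt_max_zero_pow (n : ℕ) (t : ℝ) :
    HasDerivAt (fun t : ℝ => max t 0 ^ (n + 2)) ((n + 2) * max t 0 ^ (n + 1)) t := by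
  rcases lt_trichotomy t 0 with ht | rfl | ht
  · have : (fun t : ℝ => max t 0 ^ (n + 2)) =ᶠ[nhds t] fun _ => 0 := by
      filter_upwards [gt_mem_nhds ht] with s hs
      simp [max_eq_right hs.le]
    rw [max_eq_right ht.le]
    simpa using (hasDerivAt_const t (0 : ℝ)).congr_of_eventuallyEq this
  · have h : (fun t : ℝ => max t 0 ^ (n + 2)) =O[nhds 0] fun x => ‖x - 0‖ ^ (n + 2) := by
      refine Asymptotics.IsBigO.of_bound 1 (Filter.Eventually.of_forall fun s => ?_)
      simp only [sub_zero, norm_pow, one_mul, Real.norm_eq_abs, abs_abs]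
      refine pow_le_pow_left₀ (abs_nonneg _) ?_ _
      rw [abs_of_nonneg (le_max_right _ _)]
      exact max_le (le_abs_self _) (abs_nonneg _)
    have := (h.hasFDerivAt (𝕜 := ℝ) (by omega)).hasDerivAt
    simpa using this
  · have : (fun t : ℝ => max t 0 ^ (n + 2)) =ᶠ[nhds t] fun t => t ^ (n + 2) := by
      filter_upwards [lt_mem_nhds ht] with s hs
      simp [max_eq_left hs.le]
    rw [max_eq_left ht.le]
    have h2 := (hasDerivAt_pow (n + 2) t).congr_of_eventuallyEq this
    simpa using h2

theorem contDiff_max_zero_pow (n : ℕ) : ContDiff ℝ n (fun t : ℝ => max t 0 ^ (n + 1)) := by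
  induction n with
  | zero => exact contDiff_zero.2 (by fun_prop)
  | succ n ih =>
    push_cast
    rw [contDiff_succ_iff_deriv]
    refine ⟨fun t => (hasDerivAt_max_zero_pow n t).differentiableAt, by simp, ?_⟩
    have : deriv (fun t : ℝ => max t 0 ^ (n + 1 + 1)) =
        fun t => ((n : ℝ) + 2) * max t 0 ^ (n + 1) :=
      funext fun t => (hasDerivAt_max_zero_pow n t).deriv
    rw [this]
    exact contDiff_const.mul ih

-- `d + 1` integrable derivatives give decay `(1 + ‖w‖)^(-(d+1))` of the transform, just enough for
-- integrability in dimension `d`.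
open scoped FourierTransform in
theorem integrable_fourier_of_contDiff {d : ℕ} {k : EuclideanSpace ℝ (Fin d) → ℂ}
    (hk : ContDiff ℝ (d + 1 : ℕ) k) (hc : HasCompactSupport k) : Integrable (𝓕 k) := by
  have hint : ∀ j n : ℕ, (j : ℕ∞) ≤ 0 → (n : ℕ∞) ≤ (d + 1 : ℕ) →
      Integrable (fun v => ‖v‖ ^ j * ‖iteratedFDeriv ℝ n k v‖) := by
    intro j n _ hn
    have hcont : Continuous (iteratedFDeriv ℝ n k) :=
      hk.continuous_iteratedFDeriv (by exact_mod_cast hn)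
    refine Continuous.integrable_of_hasCompactSupport (by fun_prop) ?_
    exact (hc.iteratedFDeriv n).norm.mul_left
  have hki : Integrable k := hk.continuous.integrable_of_hasCompactSupport hc
  have hcont : Continuous (𝓕 k) :=
    VectorFourier.fourierIntegral_continuous (L := innerₗ _) Real.continuous_fourierChar
      continuous_inner hki
  have hk' : ContDiff ℝ ((d + 1 : ℕ) : ℕ∞) k := by exact_mod_cast hk
  obtain ⟨C0, h0⟩ : ∃ C, ∀ w, ‖𝓕 k w‖ ≤ C :=
    ⟨_, fun w => VectorFourier.norm_fourierIntegral_le_integral_norm Real.fourierChar volume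
      (innerₗ _) k w⟩
  have hbound := fun w => Real.pow_mul_norm_iteratedFDeriv_fourier_le hk' hint (k := 0)
    (n := d + 1) (by simp) le_rfl w
  simp only [norm_iteratedFDeriv_zero] at hbound
  obtain ⟨C1, h1⟩ : ∃ C, ∀ w, ‖w‖ ^ (d + 1) * ‖𝓕 k w‖ ≤ C := ⟨_, hbound⟩
  have hI : Integrable (fun w : EuclideanSpace ℝ (Fin d) => (1 + ‖w‖) ^ (-((d : ℝ) + 1))) :=
    integrable_one_add_norm (by simp)
  refine (hI.const_mul (2 ^ d * (C0 + C1))).mono' hcont.aestronglyMeasurable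
    (Filter.Eventually.of_forall fun w => ?_)
  have hpos : 0 < (1 + ‖w‖) ^ (d + 1) := by positivity
  have e : (1 + ‖w‖) ^ (-((d : ℝ) + 1)) = ((1 + ‖w‖) ^ (d + 1))⁻¹ := by
    rw [Real.rpow_neg (by positivity)]
    congr 1
    exact_mod_cast Real.rpow_natCast (1 + ‖w‖) (d + 1)
  rw [e, ← div_eq_mul_inv, le_div_iff₀ hpos]
  have h3 : (1 + ‖w‖) ^ (d + 1) ≤ 2 ^ d * (1 ^ (d + 1) + ‖w‖ ^ (d + 1)) :=
    add_pow_le zero_le_one (norm_nonneg _) _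
  calc ‖𝓕 k w‖ * (1 + ‖w‖) ^ (d + 1)
      ≤ ‖𝓕 k w‖ * (2 ^ d * (1 ^ (d + 1) + ‖w‖ ^ (d + 1))) := by gcongr
    _ = 2 ^ d * (‖𝓕 k w‖ + ‖w‖ ^ (d + 1) * ‖𝓕 k w‖) := by ring
    _ ≤ _ := by gcongr; exacts [h0 w, h1 w]

open scoped FourierTransform in
theorem mem_wienerZero_of_integrable_fourier {d : ℕ} {k : EuclideanSpace ℝ (Fin d) → ℂ}
    (hk : Continuous k) (hki : Integrable k) (hF : Integrable (𝓕 k)) : k ∈ wienerZero d := by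
  have hinv : Integrable (𝓕⁻ k) := by
    have : 𝓕⁻ k = fun x => 𝓕 k (-x) := funext fun x => Real.fourierInv_eq_fourier_neg k x
    rw [this]; exact hF.comp_neg
  refine ⟨_, integrable_dilate hinv Real.two_pi_pos, ?_⟩
  ext y
  rw [fourierHat_dilate _ Real.two_pi_pos, ← fourier_eq_fourierHat,
    hk.fourier_fourierInv_eq hki hF]

/-- The Bochner–Riesz type kernels `(1 - |x|²)₊ᵐ` of large order are Fourier transforms of
integrable functions. -/
theorem rieszKernel_mem_wienerZero (d : ℕ) :
    (fun x : EuclideanSpace ℝ (Fin d) => ((max (1 - ‖x‖ ^ 2) 0 ^ (d + 2) : ℝ) : ℂ))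
      ∈ wienerZero d := by
  -- The power `d + 2` leaves `d + 1` continuous derivatives, as the decay estimate requires; using
  -- `‖x‖ ^ 2` avoids the singularity of the norm at the origin.
  have hC : ContDiff ℝ (d + 1 : ℕ)
      (fun x : EuclideanSpace ℝ (Fin d) => ((max (1 - ‖x‖ ^ 2) 0 ^ (d + 2) : ℝ) : ℂ)) :=
    Complex.ofRealCLM.contDiff.comp ((contDiff_max_zero_pow (d + 1)).comp
      (contDiff_const.sub (contDiff_norm_sq ℝ)))
  have hc : HasCompactSupport
      (fun x : EuclideanSpace ℝ (Fin d) => ((max (1 - ‖x‖ ^ 2) 0 ^ (d + 2) : ℝ) : ℂ)) := by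
    refine HasCompactSupport.intro (isCompact_closedBall 0 1) fun x hx => ?_
    have hx' : 1 < ‖x‖ := by simpa using hx
    have : 1 - ‖x‖ ^ 2 ≤ 0 := by nlinarith
    simp [max_eq_right this]
  exact mem_wienerZero_of_integrable_fourier hC.continuous
    (hC.continuous.integrable_of_hasCompactSupport hc) (integrable_fourier_of_contDiff hC hc)

/-! ### Superpositions of dilates. -/

/-- Integrals of dilates of an element of `W₀` lie in `W₀`. -/
theorem integral_dilates_mem_wienerZero {d : ℕ} {k : EuclideanSpace ℝ (Fin d) → ℂ}
    (hk : k ∈ wienerZero d) {w : ℝ → ℂ} (hw : IntegrableOn w (Set.Ioi 0)) :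
    (fun x => ∫ s in Set.Ioi (0 : ℝ), k ((√s)⁻¹ • x) * w s) ∈ wienerZero d := by
  obtain ⟨κ₀, hκ₀, rfl⟩ := hk
  -- A strongly measurable representative makes `(s, y) ↦ κ (√s • y)` measurable by composition,
  -- with no null sets to track.
  obtain ⟨κ, hκm, hκe⟩ := hκ₀.1
  have hκ : Integrable κ := hκ₀.congr hκe
  have hfe : fourierHat κ₀ = fourierHat κ := by
    ext y
    exact integral_congr_ae (hκe.mono fun x hx => by simp only [hx])
  rw [hfe]
  set μ : Measure ℝ := volume.restrict (Set.Ioi 0) with hμ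
  have hpos : ∀ᵐ s ∂μ, 0 < s := ae_restrict_mem measurableSet_Ioi
  let G : ℝ → EuclideanSpace ℝ (Fin d) → ℂ :=
    fun s y => ((((√s)⁻¹ ^ d)⁻¹ : ℝ) : ℂ) * κ ((√s)⁻¹⁻¹ • y)
  have hG : ∀ s, 0 < s → Integrable (G s) := fun s hs =>
    integrable_dilate hκ (inv_pos.2 (Real.sqrt_pos.2 hs))
  have hm : AEStronglyMeasurable
      (fun q : ℝ × EuclideanSpace ℝ (Fin d) => G q.1 q.2 * w q.1) (μ.prod volume) := by
    refine AEStronglyMeasurable.mul ?_ hw.1.comp_fst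
    refine StronglyMeasurable.aestronglyMeasurable ?_
    refine StronglyMeasurable.mul ?_ ?_
    · exact Measurable.stronglyMeasurable (by fun_prop)
    · exact hκm.comp_measurable (by fun_prop)
  have hI : Integrable
      (fun q : ℝ × EuclideanSpace ℝ (Fin d) => G q.1 q.2 * w q.1) (μ.prod volume) := by
    rw [integrable_prod_iff hm]
    refine ⟨?_, ?_⟩
    · filter_upwards [hpos] with s hs
      exact (hG s hs).mul_const _
    -- The `L¹` norm of `G s` does not depend on `s`, so integrability of `w` alone suffices.
    · refine (hw.norm.const_mul (∫ x, ‖κ x‖)).congr ?_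
      filter_upwards [hpos] with s hs
      simp only [norm_mul (G s _)]
      rw [integral_mul_const]
      congr 1
      exact (integral_norm_dilate κ (inv_pos.2 (Real.sqrt_pos.2 hs))).symm
  refine ⟨fun y => ∫ s, G s y * w s ∂μ, hI.integral_prod_right, ?_⟩
  ext x
  unfold fourierHat
  simp only [← integral_const_mul]
  have hI2 : Integrable (fun q : EuclideanSpace ℝ (Fin d) × ℝ =>
      Complex.exp (-Complex.I * ((inner ℝ q.1 x : ℝ) : ℂ)) * (G q.2 q.1 * w q.2))
      (volume.prod μ) := by
    refine hI.swap.bdd_mul (c := 1) (Continuous.aestronglyMeasurable (by fun_prop))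
      (Filter.Eventually.of_forall fun q => ?_)
    rw [Complex.norm_exp]
    simp
  rw [integral_integral_swap hI2]
  refine integral_congr_ae ?_
  filter_upwards [hpos] with s hs
  have := fourierHat_dilate κ (inv_pos.2 (Real.sqrt_pos.2 hs)) x
  unfold fourierHat at this
  rw [← this, ← integral_mul_const]
  simp only [G, mul_assoc]

/-! ### Conic symbols: Cauchy estimates and Taylor's formula at infinity. -/

/-- `H` is holomorphic on a conical neighbourhood of the positive half-line, tends to `H 0` at the
origin and to `k` at infinity, at power rates. -/
structure IsConicSymbol (H : ℂ → ℂ) (k : ℂ) (c δ C : ℝ) : Prop where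
  pos : 0 < c
  rate_pos : 0 < δ
  bound_nonneg : 0 ≤ C
  diff : ∀ s : ℝ, 0 < s → DifferentiableOn ℂ H (Metric.closedBall (s : ℂ) (c * s))
  near_zero : ∀ s : ℝ, 0 < s → s ≤ 1 → ∀ z ∈ Metric.closedBall (s : ℂ) (c * s),
    ‖H z - H 0‖ ≤ C * s ^ δ
  near_top : ∀ s : ℝ, 1 ≤ s → ∀ z ∈ Metric.closedBall (s : ℂ) (c * s),
    ‖H z - k‖ ≤ C * s ^ (-δ)

namespace IsConicSymbol

variable {H : ℂ → ℂ} {k : ℂ} {c δ C : ℝ}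

theorem hasDerivAt_iteratedDeriv (h : IsConicSymbol H k c δ C) (n : ℕ) {s : ℝ} (hs : 0 < s) :
    HasDerivAt (fun t : ℝ => iteratedDeriv n H (t : ℂ)) (iteratedDeriv (n + 1) H s) s := by
  have ha : AnalyticAt ℂ H s :=
    (h.diff s hs).analyticAt (Metric.closedBall_mem_nhds _ (mul_pos h.pos hs))
  have h1 := (ha.iterated_deriv n).differentiableAt.hasDerivAt
  rw [← iteratedDeriv_eq_iterate, ← iteratedDeriv_succ] at h1
  exact h1.comp_ofReal

/-- Cauchy estimates. -/
theorem exists_norm_iteratedDeriv_le (h : IsConicSymbol H k c δ C) (n : ℕ) :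
    ∃ M, 0 ≤ M ∧ ∀ s : ℝ, 0 < s →
      s ^ (n + 1) * ‖iteratedDeriv (n + 1) H s‖ ≤ M * s ^ δ ∧
      s ^ (n + 1) * ‖iteratedDeriv (n + 1) H s‖ ≤ M * s ^ (-δ) := by
  -- The constant `a`, which will be `H 0` or `k`, disappears on differentiation, and the radius `c
  -- * s` supplies the factor `s ^ (n + 1)`.
  have cauchy : ∀ (a : ℂ) (B s : ℝ), 0 < s →
      (∀ z ∈ Metric.closedBall (s : ℂ) (c * s), ‖H z - a‖ ≤ B) →
      s ^ (n + 1) * ‖iteratedDeriv (n + 1) H s‖ ≤ (n + 1).factorial / c ^ (n + 1) * B := by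
    intro a B s hs hB
    have hcs := mul_pos h.pos hs
    have hd : DifferentiableOn ℂ (fun z => H z - a) (closure (Metric.ball (s : ℂ) (c * s))) := by
      rw [closure_ball _ hcs.ne']
      exact (h.diff s hs).sub_const a
    have := Complex.norm_iteratedDeriv_le_of_forall_mem_sphere_norm_le (n + 1) hcs
      hd.diffContOnCl (fun z hz => hB z (Metric.sphere_subset_closedBall hz))
    have e : iteratedDeriv (n + 1) (fun z => H z - a) = iteratedDeriv (n + 1) H := by
      rw [iteratedDeriv_succ', iteratedDeriv_succ']
      congr 1
      ext z
      exact deriv_sub_const a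
    rw [e, mul_pow] at this
    have hc := h.pos
    calc _ ≤ s ^ (n + 1) * ((n + 1).factorial * B / (c ^ (n + 1) * s ^ (n + 1))) := by gcongr
      _ = _ := by field_simp
  refine ⟨(n + 1).factorial / c ^ (n + 1) * C, ?_, fun s hs => ?_⟩
  · have := h.pos; have := h.bound_nonneg; positivity
  have hc := h.pos
  have hC := h.bound_nonneg
  have hδ := h.rate_pos
  rcases le_total s 1 with h1 | h1
  · have := cauchy _ _ s hs (h.near_zero s hs h1)
    rw [← mul_assoc] at this
    refine ⟨this, this.trans ?_⟩
    gcongr 1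
    exact Real.rpow_le_rpow_of_exponent_ge hs h1 (by linarith)
  · have := cauchy _ _ s hs (h.near_top s h1)
    rw [← mul_assoc] at this
    refine ⟨this.trans ?_, this⟩
    gcongr 1
    exact Real.rpow_le_rpow_of_exponent_le h1 (by linarith)

/-- The Cauchy bounds dominate the integrand by multiples of `s ^ (δ - 1)` on `(0, 1]` and of `s ^
(-δ - 1)` on `(1, ∞)`. -/
theorem integrableOn_pow_mul_iteratedDeriv (h : IsConicSymbol H k c δ C) (n : ℕ) :
    IntegrableOn (fun s : ℝ => ((s ^ n : ℝ) : ℂ) * iteratedDeriv (n + 1) H s) (Set.Ioi 0) := by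
  obtain ⟨M, hM, hb⟩ := h.exists_norm_iteratedDeriv_le n
  have hcont : ContinuousOn (fun s : ℝ => ((s ^ n : ℝ) : ℂ) * iteratedDeriv (n + 1) H s)
      (Set.Ioi 0) := by
    refine ContinuousOn.mul (by fun_prop) fun s hs => ?_
    exact (h.hasDerivAt_iteratedDeriv (n + 1) hs).continuousAt.continuousWithinAt
  have hbound : ∀ (e s : ℝ), 0 < s → s ^ (n + 1) * ‖iteratedDeriv (n + 1) H s‖ ≤ M * s ^ e →
      ‖((s ^ n : ℝ) : ℂ) * iteratedDeriv (n + 1) H s‖ ≤ M * s ^ (e - 1) := by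
    intro e s hs hle
    rw [norm_mul, Complex.norm_real, Real.norm_of_nonneg (by positivity), Real.rpow_sub_one hs.ne',
      ← mul_div_assoc, le_div_iff₀ hs]
    calc _ = s ^ (n + 1) * ‖iteratedDeriv (n + 1) H s‖ := by ring
      _ ≤ _ := hle
  rw [← Set.Ioc_union_Ioi_eq_Ioi zero_le_one]
  refine IntegrableOn.union ?_ ?_
  · have hi : IntegrableOn (fun s : ℝ => M * s ^ (δ - 1)) (Set.Ioc 0 1) := by
      have := intervalIntegral.intervalIntegrable_rpow' (a := 0) (b := 1) (r := δ - 1)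
        (by linarith [h.rate_pos])
      rw [intervalIntegrable_iff_integrableOn_Ioc_of_le zero_le_one] at this
      exact this.const_mul M
    refine hi.mono' ((hcont.mono Set.Ioc_subset_Ioi_self).aestronglyMeasurable measurableSet_Ioc)
      ((ae_restrict_mem measurableSet_Ioc).mono fun s hs => ?_)
    exact hbound _ s hs.1 (hb s hs.1).1
  · have hi : IntegrableOn (fun s : ℝ => M * s ^ (-δ - 1)) (Set.Ioi 1) :=
      (integrableOn_Ioi_rpow_of_lt (by linarith [h.rate_pos]) zero_lt_one).const_mul M
    refine hi.mono' ((hcont.mono (Set.Ioi_subset_Ioi zero_le_one)).aestronglyMeasurable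
      measurableSet_Ioi) ((ae_restrict_mem measurableSet_Ioi).mono fun s hs => ?_)
    have hs0 : (0 : ℝ) < s := zero_lt_one.trans hs
    exact hbound _ s hs0 (hb s hs0).2

theorem integrableOn_sub_pow_mul_iteratedDeriv (h : IsConicSymbol H k c δ C) (n : ℕ) {u : ℝ}
    (hu : 0 ≤ u) :
    IntegrableOn (fun s : ℝ => (((s - u) ^ n : ℝ) : ℂ) * iteratedDeriv (n + 1) H s)
      (Set.Ioi u) := by
  have hi := (h.integrableOn_pow_mul_iteratedDeriv n).mono_set (Set.Ioi_subset_Ioi hu)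
  refine hi.norm.mono' ?_ ((ae_restrict_mem measurableSet_Ioi).mono fun s hs => ?_)
  · refine ContinuousOn.aestronglyMeasurable ?_ measurableSet_Ioi
    refine ContinuousOn.mul (by fun_prop) fun s hs => ?_
    exact (h.hasDerivAt_iteratedDeriv (n + 1) (hu.trans_lt hs)).continuousAt.continuousWithinAt
  · have hs' : u < s := hs
    have : 0 < s := hu.trans_lt hs'
    rw [norm_mul, norm_mul, Complex.norm_real, Complex.norm_real,
      Real.norm_of_nonneg (pow_nonneg (sub_nonneg.2 hs'.le) _), Real.norm_of_nonneg (by positivity)]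
    have h1 : s - u ≤ s := by linarith
    have h2 : 0 ≤ s - u := by linarith
    gcongr

/-- Taylor's formula with base point at infinity. -/
theorem integral_sub_pow_mul_iteratedDeriv (h : IsConicSymbol H k c δ C) (n : ℕ) {u : ℝ}
    (hu : 0 ≤ u) :
    ∫ s in Set.Ioi u, (((s - u) ^ n : ℝ) : ℂ) * iteratedDeriv (n + 1) H s =
      (-1) ^ n * n.factorial * (k - H u) := by
  have hδ := h.rate_pos
  induction n with
  | zero =>
    have hint := h.integrableOn_sub_pow_mul_iteratedDeriv 0 hu
    simp only [pow_zero, Complex.ofReal_one, one_mul, zero_add, Nat.factorial_zero,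
      Nat.cast_one] at hint ⊢
    have hder : ∀ s : ℝ, 0 < s →
        HasDerivAt (fun t : ℝ => H t) (iteratedDeriv 1 H s) s := fun s hs => by
      simpa using h.hasDerivAt_iteratedDeriv 0 hs
    refine integral_Ioi_of_hasDerivAt_of_tendsto (f := fun t : ℝ => H t) ?_
      (fun s hs => hder s (hu.trans_lt hs)) hint ?_
    -- At `u = 0` there is no holomorphy to give continuity; `near_zero` provides it from the right.
    · rcases hu.eq_or_lt with rfl | hu
      · rw [ContinuousWithinAt, tendsto_iff_norm_sub_tendsto_zero]
        have hlim : Filter.Tendsto (fun s : ℝ => C * s ^ δ) (nhdsWithin 0 (Set.Ici 0))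
            (nhds 0) := by
          have := ((Real.continuous_rpow_const hδ.le).tendsto (0 : ℝ)).const_mul C
          rw [Real.zero_rpow hδ.ne', mul_zero] at this
          exact this.mono_left nhdsWithin_le_nhds
        refine squeeze_zero' (Filter.Eventually.of_forall fun s => norm_nonneg _) ?_ hlim
        filter_upwards [self_mem_nhdsWithin, nhdsWithin_le_nhds (Iic_mem_nhds zero_lt_one)]
          with s hs hs1
        rcases (show (0 : ℝ) ≤ s from hs).eq_or_lt with rfl | hs0
        · simp [Real.zero_rpow hδ.ne']
        · simpa using h.near_zero s hs0 hs1 s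
            (Metric.mem_closedBall_self (mul_pos h.pos hs0).le)
      · exact (hder u hu).continuousAt.continuousWithinAt
    · rw [tendsto_iff_norm_sub_tendsto_zero]
      have hlim : Filter.Tendsto (fun s : ℝ => C * s ^ (-δ)) Filter.atTop (nhds 0) := by
        simpa using (tendsto_rpow_neg_atTop hδ).const_mul C
      refine squeeze_zero' (Filter.Eventually.of_forall fun s => norm_nonneg _) ?_ hlim
      filter_upwards [Filter.eventually_ge_atTop 1] with s hs
      exact h.near_top s hs s
        (Metric.mem_closedBall_self (mul_pos h.pos (zero_lt_one.trans_le hs)).le)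
  | succ n ih =>
    have hint0 := h.integrableOn_sub_pow_mul_iteratedDeriv n hu
    have hint1 := h.integrableOn_sub_pow_mul_iteratedDeriv (n + 1) hu
    obtain ⟨M, hM, hb⟩ := h.exists_norm_iteratedDeriv_le n
    set f : ℝ → ℂ := fun s => (((s - u) ^ (n + 1) : ℝ) : ℂ) * iteratedDeriv (n + 1) H s with hf
    have hle : ∀ s, 0 < s → u ≤ s → ‖f s‖ ≤ s ^ (n + 1) * ‖iteratedDeriv (n + 1) H s‖ := by
      intro s hs hus
      have h2 : 0 ≤ s - u := by linarith
      have h1 : s - u ≤ s := by linarith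
      rw [hf, norm_mul, Complex.norm_real, Real.norm_of_nonneg (by positivity)]
      gcongr
    have hder : ∀ s, 0 < s → HasDerivAt f ((n + 1) * ((((s - u) ^ n : ℝ) : ℂ) *
        iteratedDeriv (n + 1) H s) + (((s - u) ^ (n + 1) : ℝ) : ℂ) *
        iteratedDeriv (n + 1 + 1) H s) s := by
      intro s hs
      have h1 : HasDerivAt (fun s : ℝ => (((s - u) ^ (n + 1) : ℝ) : ℂ))
          (((n + 1 : ℕ) * (s - u) ^ n * 1 : ℝ) : ℂ) s :=
        (((hasDerivAt_id s).sub_const u).pow (n + 1)).ofReal_comp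
      refine (h1.mul (h.hasDerivAt_iteratedDeriv (n + 1) hs)).congr_deriv ?_
      push_cast
      ring
    -- Integration by parts: `f` vanishes at both ends, so the integrals of the two terms of its
    -- derivative cancel.
    have key := integral_Ioi_of_hasDerivAt_of_tendsto (f := f) (a := u) (m := 0) ?_
      (fun s hs => hder s (hu.trans_lt hs)) ((hint0.const_mul _).add hint1) ?_
    · have hfu : f u = 0 := by simp [hf]
      rw [integral_add (hint0.const_mul _) hint1, integral_const_mul, ih, hfu, sub_zero] at key
      rw [eq_neg_of_add_eq_zero_right key, pow_succ, Nat.factorial_succ]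
      push_cast
      ring
    -- For `u = 0` the derivative of `H` may blow up at the endpoint, so the limit comes from the
    -- bound `M * s ^ δ`.
    · rcases hu.eq_or_lt with rfl | hu
      · have hf0 : f 0 = 0 := by simp [hf]
        rw [ContinuousWithinAt, hf0, tendsto_zero_iff_norm_tendsto_zero]
        have hlim : Filter.Tendsto (fun s : ℝ => M * s ^ δ) (nhdsWithin 0 (Set.Ici 0))
            (nhds 0) := by
          have := ((Real.continuous_rpow_const hδ.le).tendsto (0 : ℝ)).const_mul M
          rw [Real.zero_rpow hδ.ne', mul_zero] at this
          exact this.mono_left nhdsWithin_le_nhds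
        refine squeeze_zero' (Filter.Eventually.of_forall fun s => norm_nonneg _) ?_ hlim
        filter_upwards [self_mem_nhdsWithin] with s hs
        rcases (show (0 : ℝ) ≤ s from hs).eq_or_lt with rfl | hs0
        · simp [Real.zero_rpow hδ.ne', hf0]
        · exact (hle s hs0 hs0.le).trans (hb s hs0).1
      · exact (hder u hu).continuousAt.continuousWithinAt
    · rw [tendsto_zero_iff_norm_tendsto_zero]
      have hlim : Filter.Tendsto (fun s : ℝ => M * s ^ (-δ)) Filter.atTop (nhds 0) := by
        simpa using (tendsto_rpow_neg_atTop hδ).const_mul M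
      refine squeeze_zero' (Filter.Eventually.of_forall fun s => norm_nonneg _) ?_ hlim
      filter_upwards [Filter.eventually_ge_atTop u, Filter.eventually_gt_atTop 0] with s hs hs0
      exact (hle s hs0 hs).trans (hb s hs0).2

/-- Radial functions generated by a conic symbol belong to the Wiener algebra. -/
theorem radial_mem_wienerZero (h : IsConicSymbol H k c δ C) (d : ℕ) :
    (fun x : EuclideanSpace ℝ (Fin d) => H ((‖x‖ ^ 2 : ℝ) : ℂ) - k) ∈ wienerZero d := by
  -- The Taylor order is the exponent of the Riesz kernel; `A` inverts the constant in Taylor's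
  -- formula, with the sign turning `k - H` into `H - k`.
  set n := d + 2 with hn
  set A : ℂ := -((-1 : ℂ) ^ n * (n.factorial : ℂ))⁻¹ with hA
  have hw : IntegrableOn
      (fun s : ℝ => A * (((s ^ n : ℝ) : ℂ) * iteratedDeriv (n + 1) H s)) (Set.Ioi 0) :=
    (h.integrableOn_pow_mul_iteratedDeriv n).const_mul A
  convert integral_dilates_mem_wienerZero (rieszKernel_mem_wienerZero d) hw using 1
  ext x
  have hT := h.integral_sub_pow_mul_iteratedDeriv n (sq_nonneg ‖x‖)
  have h0 : ((-1 : ℂ) ^ n * n.factorial) ≠ 0 :=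
    mul_ne_zero (pow_ne_zero _ (by norm_num)) (by exact_mod_cast n.factorial_ne_zero)
  have e1 : H ((‖x‖ ^ 2 : ℝ) : ℂ) - k = A * ∫ s in Set.Ioi (‖x‖ ^ 2),
      (((s - ‖x‖ ^ 2) ^ n : ℝ) : ℂ) * iteratedDeriv (n + 1) H s := by
    rw [hT, hA, neg_mul, inv_mul_cancel_left₀ h0, neg_sub]
  rw [e1, ← integral_const_mul]
  have hsub : Set.Ioi (‖x‖ ^ 2) ⊆ Set.Ioi 0 := Set.Ioi_subset_Ioi (sq_nonneg _)
  -- The truncated kernel vanishes for `s ≤ ‖x‖ ^ 2`, so the integral extends to all of `(0, ∞)`.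
  refine Eq.trans ?_
    (setIntegral_eq_of_subset_of_forall_sdiff_eq_zero measurableSet_Ioi hsub ?_).symm
  · refine setIntegral_congr_fun measurableSet_Ioi fun s hs => ?_
    have hs' : ‖x‖ ^ 2 < s := hs
    have hs0 : 0 < s := hsub hs
    have e2 : ‖(√s)⁻¹ • x‖ ^ 2 = ‖x‖ ^ 2 / s := by
      rw [norm_smul, mul_pow, norm_inv, inv_pow, Real.norm_of_nonneg (Real.sqrt_nonneg s),
        Real.sq_sqrt hs0.le, inv_mul_eq_div]
    have e3 : (s - ‖x‖ ^ 2) ^ n = max (1 - ‖x‖ ^ 2 / s) 0 ^ n * s ^ n := by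
      rw [max_eq_left (sub_nonneg.2 ((div_le_one hs0).2 hs'.le)), ← mul_pow]
      congr 1
      field_simp
    simp only [e2]
    rw [e3]
    push_cast
    ring
  · intro s hs
    have hs0 : (0 : ℝ) < s := hs.1
    have hs1 : s ≤ ‖x‖ ^ 2 := not_lt.1 hs.2
    have e2 : ‖(√s)⁻¹ • x‖ ^ 2 = ‖x‖ ^ 2 / s := by
      rw [norm_smul, mul_pow, norm_inv, inv_pow, Real.norm_of_nonneg (Real.sqrt_nonneg s),
        Real.sq_sqrt hs0.le, inv_mul_eq_div]
    have : 1 - ‖x‖ ^ 2 / s ≤ 0 := sub_nonpos.2 ((one_le_div hs0).2 hs1)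
    simp [e2, max_eq_right this]

end IsConicSymbol

/-! ### The symbols `exp(-z^a)` and their quotients. -/

/-- On narrow cones around the positive half-line the power `z ^ a` stays close to the positive
half-line. -/
theorem eventually_norm_cpow_sub_rpow_le {a : ℝ} :
    ∀ᶠ c in nhdsWithin (0 : ℝ) (Set.Ioi 0), ∀ s : ℝ, 0 < s →
      ∀ z ∈ Metric.closedBall (s : ℂ) (c * s), z ∈ Complex.slitPlane ∧
        ‖z ^ (a : ℂ) - ((s ^ a : ℝ) : ℂ)‖ ≤ s ^ a / 2 := by
  -- By homogeneity, with `w = z / s`, everything reduces to continuity of `w ^ a` at `1`; hence `c`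
  -- is uniform in `s`.
  have hc : ContinuousAt (fun w : ℂ => w ^ (a : ℂ)) 1 :=
    continuousAt_cpow_const (Or.inl (by simp))
  have h1 : ∀ᶠ w in nhds (1 : ℂ), w ∈ Complex.slitPlane ∧ ‖w ^ (a : ℂ) - 1‖ < 1 / 2 := by
    refine Filter.Eventually.and
      (Complex.isOpen_slitPlane.mem_nhds Complex.one_mem_slitPlane) ?_
    have := Metric.tendsto_nhds.1 hc (1 / 2) (by norm_num)
    simpa [dist_eq_norm] using this
  obtain ⟨η, hη, hball⟩ := Metric.eventually_nhds_iff.1 h1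
  filter_upwards [nhdsWithin_le_nhds (gt_mem_nhds hη)] with c hc s hs z hz
  have hs' : (s : ℂ) ≠ 0 := by exact_mod_cast hs.ne'
  have hw : dist (z / s) 1 < η := by
    rw [dist_eq_norm, div_sub_one hs', norm_div, Complex.norm_real, Real.norm_of_nonneg hs.le,
      div_lt_iff₀ hs]
    rw [Metric.mem_closedBall, dist_eq_norm] at hz
    exact hz.trans_lt (mul_lt_mul_of_pos_right hc hs)
  obtain ⟨hsl, hle⟩ := hball hw
  have hzs : z = (s : ℂ) * (z / s) := by field_simp
  have hz0 : z / s ≠ 0 := Complex.slitPlane_ne_zero hsl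
  have e : z ^ (a : ℂ) = ((s ^ a : ℝ) : ℂ) * (z / s) ^ (a : ℂ) := by
    have hzne : z ≠ 0 := by rw [hzs]; exact mul_ne_zero hs' hz0
    rw [Complex.ofReal_cpow hs.le, Complex.cpow_def_of_ne_zero hzne,
      Complex.cpow_def_of_ne_zero hs', Complex.cpow_def_of_ne_zero hz0, ← Complex.exp_add,
      ← add_mul, ← Complex.ofReal_log hs.le, ← Complex.log_ofReal_mul hs hz0, ← hzs]
  refine ⟨?_, ?_⟩
  · rw [hzs]
    rw [Complex.mem_slitPlane_iff] at hsl ⊢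
    rw [Complex.re_ofReal_mul, Complex.im_ofReal_mul]
    exact hsl.imp (mul_pos hs) (mul_ne_zero hs.ne')
  · have : z ^ (a : ℂ) - ((s ^ a : ℝ) : ℂ) = ((s ^ a : ℝ) : ℂ) * ((z / s) ^ (a : ℂ) - 1) := by
      rw [e]; ring
    have hsa : 0 < s ^ a := Real.rpow_pos_of_pos hs a
    rw [this, norm_mul, Complex.norm_real, Real.norm_of_nonneg hsa.le]
    nlinarith [hle.le]

section exp

variable {v : ℂ} {t : ℝ}

theorem half_le_re_of_norm_sub_le (hv : ‖v - (t : ℂ)‖ ≤ t / 2) : t / 2 ≤ v.re := by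
  have := (Complex.abs_re_le_norm (v - t)).trans hv
  rw [abs_le] at this
  simp only [Complex.sub_re, Complex.ofReal_re] at this
  linarith [this.1]

theorem norm_exp_neg_le_of_norm_sub_le (hv : ‖v - (t : ℂ)‖ ≤ t / 2) :
    ‖Complex.exp (-v)‖ ≤ Real.exp (-(t / 2)) := by
  rw [Complex.norm_exp, Complex.neg_re]
  exact Real.exp_le_exp.2 (neg_le_neg (half_le_re_of_norm_sub_le hv))

theorem norm_exp_neg_le_div (ht : 0 < t) (hv : ‖v - (t : ℂ)‖ ≤ t / 2) :
    ‖Complex.exp (-v)‖ ≤ 2 * t⁻¹ := by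
  refine (norm_exp_neg_le_of_norm_sub_le hv).trans ?_
  rw [Real.exp_neg, inv_le_comm₀ (Real.exp_pos _) (by positivity), mul_inv, inv_inv]
  linarith [Real.add_one_le_exp (t / 2)]

/-- Since `‖v‖ ≤ 3t/2`, it suffices that `‖exp(-v) - 1‖ ≤ 2‖v‖`: standard for `‖v‖ ≤ 1`, and
otherwise a consequence of `‖exp(-v)‖ ≤ 1`. -/
theorem norm_exp_neg_sub_one_le (ht : 0 < t) (hv : ‖v - (t : ℂ)‖ ≤ t / 2) :
    ‖Complex.exp (-v) - 1‖ ≤ 3 * t := by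
  have hvn : ‖v‖ ≤ 3 / 2 * t := by
    calc ‖v‖ = ‖(v - t) + t‖ := by ring_nf
      _ ≤ ‖v - t‖ + ‖(t : ℂ)‖ := norm_add_le _ _
      _ ≤ 3 / 2 * t := by
        rw [Complex.norm_real, Real.norm_of_nonneg ht.le]; linarith
  have h2 : ‖Complex.exp (-v) - 1‖ ≤ 2 * ‖v‖ := by
    rcases le_total ‖v‖ 1 with h | h
    · simpa using Complex.norm_exp_sub_one_le (x := -v) (by simpa using h)
    · have h3 := norm_exp_neg_le_of_norm_sub_le hv
      have h4 : Real.exp (-(t / 2)) ≤ 1 := Real.exp_le_one_iff.2 (by linarith)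
      have h5 := norm_sub_le (Complex.exp (-v)) 1
      rw [norm_one] at h5
      linarith
  linarith

/-- Here `‖exp(-v)‖ ≤ 1/(1 + t/2)`, and `1 - 1/(1 + t/2) = t/(2 + t)`. This keeps the denominator of
the quotient away from zero on the cone, with the right order near the origin. -/
theorem min_one_le_norm_one_sub_exp_neg (ht : 0 < t) (hv : ‖v - (t : ℂ)‖ ≤ t / 2) :
    min 1 t / 3 ≤ ‖1 - Complex.exp (-v)‖ := by
  have h1 := norm_sub_norm_le (1 : ℂ) (Complex.exp (-v))
  rw [norm_one] at h1
  have h2 := norm_exp_neg_le_of_norm_sub_le hv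
  have h3 : Real.exp (-(t / 2)) ≤ (1 + t / 2)⁻¹ := by
    rw [Real.exp_neg]
    exact inv_anti₀ (by positivity) (by linarith [Real.add_one_le_exp (t / 2)])
  have h4 : min 1 t / 3 ≤ 1 - (1 + t / 2)⁻¹ := by
    have e : 1 - (1 + t / 2)⁻¹ = t / (2 + t) := by field_simp; ring
    rw [e, div_le_div_iff₀ (by norm_num) (by positivity)]
    rcases le_total 1 t with h | h
    · rw [min_eq_left h]; linarith
    · rw [min_eq_right h]; nlinarith
  linarith

end exp

theorem differentiableAt_exp_neg_cpow {z : ℂ} (hz : z ∈ Complex.slitPlane) (a : ℝ) :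
    DifferentiableAt ℂ (fun z : ℂ => Complex.exp (-z ^ (a : ℂ))) z :=
  ((differentiableAt_id.cpow_const hz).neg).cexp

theorem exists_isConicSymbol_exp_neg_cpow {a : ℝ} (ha : 0 < a) :
    ∃ c δ C, IsConicSymbol (fun z => Complex.exp (-z ^ (a : ℂ))) 0 c δ C := by
  obtain ⟨c, hc, hc0⟩ :=
    ((eventually_norm_cpow_sub_rpow_le (a := a)).and self_mem_nhdsWithin).exists
  have ha' : (a : ℂ) ≠ 0 := by exact_mod_cast ha.ne'
  refine ⟨c, a, 3, hc0, ha, by norm_num, ?_, ?_, ?_⟩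
  · intro s hs z hz
    exact (differentiableAt_exp_neg_cpow (hc s hs z hz).1 a).differentiableWithinAt
  · intro s hs _ z hz
    simp only [Complex.zero_cpow ha', neg_zero, Complex.exp_zero]
    exact norm_exp_neg_sub_one_le (Real.rpow_pos_of_pos hs a) (hc s hs z hz).2
  · intro s hs z hz
    have hs0 : 0 < s := zero_lt_one.trans_le hs
    rw [sub_zero, Real.rpow_neg hs0.le]
    have hp := Real.rpow_pos_of_pos hs0 a
    refine (norm_exp_neg_le_div hp (hc s hs0 z hz).2).trans ?_
    gcongr
    norm_num

/-- Near the origin the quotient is `O(s^(b-a))`, which also matches the value `0/0 = 0`; at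
infinity its distance to `1` is `O(s^(-a))`. Hence the rate `min a (b - a)`; the constants found are
`9` and `12`. -/
theorem exists_isConicSymbol_ratio {a b : ℝ} (ha : 0 < a) (hab : a < b) :
    ∃ c δ C, IsConicSymbol (fun z => (1 - Complex.exp (-z ^ (b : ℂ))) /
      (1 - Complex.exp (-z ^ (a : ℂ)))) 1 c δ C := by
  -- One cone aperture has to serve both exponents.
  obtain ⟨c, ⟨hca, hcb⟩, hc0⟩ := (((eventually_norm_cpow_sub_rpow_le (a := a)).and
    (eventually_norm_cpow_sub_rpow_le (a := b))).and self_mem_nhdsWithin).exists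
  have ha' : (a : ℂ) ≠ 0 := by exact_mod_cast ha.ne'
  have hb' : (b : ℂ) ≠ 0 := by exact_mod_cast (ha.trans hab).ne'
  have hlow : ∀ s : ℝ, 0 < s → ∀ z ∈ Metric.closedBall (s : ℂ) (c * s),
      min 1 (s ^ a) / 3 ≤ ‖1 - Complex.exp (-z ^ (a : ℂ))‖ := fun s hs z hz =>
    min_one_le_norm_one_sub_exp_neg (Real.rpow_pos_of_pos hs a) (hca s hs z hz).2
  have hlowpos : ∀ s : ℝ, 0 < s → 0 < min 1 (s ^ a) / 3 := fun s hs =>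
    div_pos (lt_min zero_lt_one (Real.rpow_pos_of_pos hs a)) (by norm_num)
  refine ⟨c, min a (b - a), 12, hc0, lt_min ha (sub_pos.2 hab), by norm_num, ?_, ?_, ?_⟩
  · intro s hs z hz
    have hsl := (hca s hs z hz).1
    refine DifferentiableAt.differentiableWithinAt ?_
    refine ((differentiableAt_const _).sub (differentiableAt_exp_neg_cpow hsl b)).div
      ((differentiableAt_const _).sub (differentiableAt_exp_neg_cpow hsl a)) ?_
    exact norm_pos_iff.1 ((hlowpos s hs).trans_le (hlow s hs z hz))
  · intro s hs hs1 z hz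
    have hl := hlow s hs z hz
    rw [min_eq_right (Real.rpow_le_one hs.le hs1 ha.le)] at hl
    have hu := norm_exp_neg_sub_one_le (Real.rpow_pos_of_pos hs b) (hcb s hs z hz).2
    rw [norm_sub_rev] at hu
    have hpa := Real.rpow_pos_of_pos hs a
    simp only [Complex.zero_cpow ha', Complex.zero_cpow hb', neg_zero, Complex.exp_zero, sub_self,
      zero_div, sub_zero, norm_div]
    calc _ ≤ 3 * s ^ b / (s ^ a / 3) := by gcongr
      _ = 9 * s ^ (b - a) := by rw [Real.rpow_sub hs]; field_simp; norm_num
      _ ≤ 12 * s ^ min a (b - a) := by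
        gcongr ?_ * ?_
        · norm_num
        · exact Real.rpow_le_rpow_of_exponent_ge hs hs1 (min_le_right _ _)
  · intro s hs z hz
    have hs0 : 0 < s := zero_lt_one.trans_le hs
    have hl := hlow s hs0 z hz
    rw [min_eq_left (Real.one_le_rpow hs ha.le)] at hl
    have hne : 1 - Complex.exp (-z ^ (a : ℂ)) ≠ 0 :=
      norm_pos_iff.1 ((hlowpos s hs0).trans_le (hlow s hs0 z hz))
    have hua := norm_exp_neg_le_div (Real.rpow_pos_of_pos hs0 a) (hca s hs0 z hz).2
    have hub := norm_exp_neg_le_div (Real.rpow_pos_of_pos hs0 b) (hcb s hs0 z hz).2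
    rw [← Real.rpow_neg hs0.le] at hua hub
    have hba : s ^ (-b) ≤ s ^ (-a) := Real.rpow_le_rpow_of_exponent_le hs (by linarith)
    have hnum : ‖Complex.exp (-z ^ (a : ℂ)) - Complex.exp (-z ^ (b : ℂ))‖ ≤ 4 * s ^ (-a) := by
      refine (norm_sub_le _ _).trans ?_
      linarith
    have e : (1 - Complex.exp (-z ^ (b : ℂ))) / (1 - Complex.exp (-z ^ (a : ℂ))) - 1 =
        (Complex.exp (-z ^ (a : ℂ)) - Complex.exp (-z ^ (b : ℂ))) /
          (1 - Complex.exp (-z ^ (a : ℂ))) := by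
      rw [div_sub_one hne]; ring
    rw [e, norm_div]
    calc _ ≤ 4 * s ^ (-a) / (1 / 3) := by gcongr
      _ = 12 * s ^ (-a) := by ring
      _ ≤ 12 * s ^ (-min a (b - a)) := by
        gcongr 12 * ?_
        exact Real.rpow_le_rpow_of_exponent_le hs (neg_le_neg (min_le_left _ _))

/-! ### The functions `φ_γ`, their transforms and the kernels of the means. -/

theorem exp_neg_cpow_norm_sq {d : ℕ} (γ : ℝ) (x : EuclideanSpace ℝ (Fin d)) :
    Complex.exp (-((‖x‖ ^ 2 : ℝ) : ℂ) ^ ((γ / 2 : ℝ) : ℂ)) = gwPhi d γ x := by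
  rw [gwPhi, ← Complex.ofReal_cpow (by positivity), ← Real.rpow_natCast_mul (norm_nonneg x)]
  push_cast
  rw [mul_div_cancel₀ _ (two_ne_zero' ℝ)]

theorem gwPhi_mem_wienerZero (d : ℕ) {γ : ℝ} (hγ : 0 < γ) : gwPhi d γ ∈ wienerZero d := by
  obtain ⟨c, δ, C, h⟩ := exists_isConicSymbol_exp_neg_cpow (half_pos hγ)
  convert h.radial_mem_wienerZero d using 1
  ext x
  rw [sub_zero, exp_neg_cpow_norm_sq]

theorem gwRatio_sub_one_mem_wienerZero (d : ℕ) {α β : ℝ} (hα : 0 < α) (hαβ : α < β) :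
    (fun x => gwRatio d α β x - 1) ∈ wienerZero d := by
  obtain ⟨c, δ, C, h⟩ := exists_isConicSymbol_ratio (half_pos hα)
    (div_lt_div_of_pos_right hαβ two_pos)
  convert h.radial_mem_wienerZero d using 1
  ext x
  rw [exp_neg_cpow_norm_sq, exp_neg_cpow_norm_sq, gwRatio]

theorem continuous_gwPhi (d : ℕ) {γ : ℝ} (hγ : 0 < γ) : Continuous (gwPhi d γ) := by
  have : Continuous fun x : EuclideanSpace ℝ (Fin d) => ‖x‖ ^ γ :=
    (Real.continuous_rpow_const hγ.le).comp continuous_norm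
  unfold gwPhi
  fun_prop

theorem integrable_gwPhi (d : ℕ) {γ : ℝ} (hγ : 0 < γ) : Integrable (gwPhi d γ) := by
  -- With `γ n ≥ d + 1`, the bound `exp t ≥ t^n / n!` at `t = ‖x‖ ^ γ` gives decay of order `d + 1`.
  obtain ⟨n, hn⟩ := exists_nat_ge ((d + 1) / γ)
  have hn' : (d : ℝ) + 1 ≤ γ * n := by rwa [div_le_iff₀' hγ] at hn
  have hI : Integrable (fun x : EuclideanSpace ℝ (Fin d) => (1 + ‖x‖) ^ (-((d : ℝ) + 1))) :=
    integrable_one_add_norm (by simp)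
  refine (hI.const_mul (n.factorial * 2 ^ ((d : ℝ) + 1))).mono'
    (continuous_gwPhi d hγ).aestronglyMeasurable (Filter.Eventually.of_forall fun x => ?_)
  have hpos : 0 < (1 + ‖x‖) ^ ((d : ℝ) + 1) := by positivity
  have hfac : (1 : ℝ) ≤ n.factorial := by exact_mod_cast n.factorial_pos
  have h0 := norm_nonneg x
  rw [gwPhi, Complex.norm_real, Real.norm_of_nonneg (Real.exp_pos _).le,
    Real.rpow_neg (by positivity), ← div_eq_mul_inv, le_div_iff₀ hpos]
  rcases le_total ‖x‖ 1 with h | h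
  · have h1 : Real.exp (-‖x‖ ^ γ) ≤ n.factorial :=
      (Real.exp_le_one_iff.2 (neg_nonpos.2 (by positivity))).trans hfac
    gcongr
    linarith
  · have h1 : Real.exp (-‖x‖ ^ γ) * ‖x‖ ^ ((d : ℝ) + 1) ≤ n.factorial := by
      have h2 := Real.pow_div_factorial_le_exp (‖x‖ ^ γ) (by positivity) n
      rw [← Real.rpow_mul_natCast h0, div_le_iff₀ (by positivity)] at h2
      rw [Real.exp_neg, inv_mul_le_iff₀ (Real.exp_pos _)]
      exact (Real.rpow_le_rpow_of_exponent_le h hn').trans h2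
    calc _ ≤ Real.exp (-‖x‖ ^ γ) * (2 * ‖x‖) ^ ((d : ℝ) + 1) := by gcongr; linarith
      _ = (Real.exp (-‖x‖ ^ γ) * ‖x‖ ^ ((d : ℝ) + 1)) * 2 ^ ((d : ℝ) + 1) := by
        rw [Real.mul_rpow (by norm_num) h0]; ring
      _ ≤ _ := by gcongr

theorem fourierHat_comp_neg {d : ℕ} (g : EuclideanSpace ℝ (Fin d) → ℂ)
    (y : EuclideanSpace ℝ (Fin d)) : fourierHat (fun x => g (-x)) y = fourierHat g (-y) := by
  unfold fourierHat
  rw [← integral_neg_eq_self]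
  simp

/-- No decay estimate for the transform is needed: `φ_γ = ĝ` with both `g` and `φ_γ` integrable, so
inversion identifies the normalised transform of `φ_γ` with the reflection of `g`. Evenness of `φ_γ`
removes the reflection. -/
theorem fourierHat_gwPhi (d : ℕ) {γ : ℝ} (hγ : 0 < γ) :
    Integrable (fourierHat (gwPhi d γ)) ∧
      ∀ y, fourierHat (fun x => 1 / (2 * (Real.pi : ℂ)) ^ d * fourierHat (gwPhi d γ) x) y
        = gwPhi d γ y := by
  obtain ⟨g, hg, hφ⟩ := gwPhi_mem_wienerZero d hγ
  have hi := integrable_gwPhi d hγ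
  rw [hφ] at hi
  obtain ⟨h1, h2⟩ := fourierHat_inversion hg hi
  rw [← hφ] at h1 h2
  refine ⟨h1, fun y => ?_⟩
  have h3 : fourierHat (fun x => 1 / (2 * (Real.pi : ℂ)) ^ d * fourierHat (gwPhi d γ) x) y
      = fourierHat (fun x => g (-x)) y :=
    integral_congr_ae (h2.mono fun x hx => by simp only [hx])
  rw [h3, fourierHat_comp_neg, ← hφ]
  simp [gwPhi]

/-- The convolution kernel of the mean `gwMean γ ε`. -/
noncomputable def gwKernel (d : ℕ) (γ ε : ℝ) (x : EuclideanSpace ℝ (Fin d)) : ℂ :=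
  (((ε ^ d)⁻¹ : ℝ) : ℂ) * (1 / (2 * (Real.pi : ℂ)) ^ d * fourierHat (gwPhi d γ) (ε⁻¹ • x))

theorem integrable_gwKernel (d : ℕ) {γ ε : ℝ} (hγ : 0 < γ) (hε : 0 < ε) :
    Integrable (gwKernel d γ ε) :=
  integrable_dilate ((fourierHat_gwPhi d hγ).1.const_mul _) hε

theorem fourierHat_gwKernel (d : ℕ) {γ ε : ℝ} (hγ : 0 < γ) (hε : 0 < ε)
    (y : EuclideanSpace ℝ (Fin d)) : fourierHat (gwKernel d γ ε) y = gwPhi d γ (ε • y) :=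
  (fourierHat_dilate _ hε y).trans ((fourierHat_gwPhi d hγ).2 _)

theorem gwKernel_smul {d : ℕ} (γ : ℝ) {ε : ℝ} (hε : 0 < ε) (y : EuclideanSpace ℝ (Fin d)) :
    gwKernel d γ ε (ε • y) =
      (((ε ^ d)⁻¹ : ℝ) : ℂ) * (1 / (2 * (Real.pi : ℂ)) ^ d * fourierHat (gwPhi d γ) y) := by
  rw [gwKernel, smul_smul, inv_mul_cancel₀ hε.ne', one_smul]

theorem gwMean_eq_convolution {d : ℕ} (γ : ℝ) {ε : ℝ} (hε : 0 < ε)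
    (f : EuclideanSpace ℝ (Fin d) → ℂ) :
    gwMean γ ε f = gwKernel d γ ε ⋆[ContinuousLinearMap.mul ℂ ℂ, volume] f := by
  ext x
  have h := Measure.integral_comp_smul (volume : Measure (EuclideanSpace ℝ (Fin d)))
    (fun t => gwKernel d γ ε t * f (x - t)) ε
  simp only [finrank_euclideanSpace, Fintype.card_fin] at h
  have hd : (ε ^ d)⁻¹ ≠ 0 := by positivity
  rw [abs_of_pos (by positivity)] at h
  refine smul_right_injective ℂ hd ?_
  simp only [convolution_def, ContinuousLinearMap.mul_apply']
  rw [← h, gwMean, Complex.real_smul, ← integral_const_mul, ← integral_const_mul]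
  refine integral_congr_ae (Filter.Eventually.of_forall fun y => ?_)
  simp only [gwKernel_smul γ hε]
  ring

theorem integrable_fourierHat_gwPhi_mul {d : ℕ} {γ ε : ℝ} (hε : 0 < ε)
    {f : EuclideanSpace ℝ (Fin d) → ℂ} {x : EuclideanSpace ℝ (Fin d)}
    (h : ConvolutionExistsAt (gwKernel d γ ε) f x (ContinuousLinearMap.mul ℂ ℂ) volume) :
    Integrable (fun y => fourierHat (gwPhi d γ) y * f (x - ε • y)) := by
  have h1 := (h.integrable.comp_smul hε.ne').const_mul ((ε : ℂ) ^ d * (2 * (Real.pi : ℂ)) ^ d)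
  refine h1.congr (Filter.Eventually.of_forall fun y => ?_)
  have hd : (ε : ℂ) ^ d ≠ 0 := by exact_mod_cast (pow_pos hε d).ne'
  have hd2 : (2 * (Real.pi : ℂ)) ^ d ≠ 0 := by exact_mod_cast (pow_pos Real.two_pi_pos d).ne'
  simp only [ContinuousLinearMap.mul_apply', gwKernel_smul γ hε]
  push_cast
  field_simp

/-- The denominator vanishes only at the origin, where the left side is zero too. -/
theorem one_sub_gwPhi_eq (d : ℕ) {α β : ℝ} (hα : 0 < α) (hαβ : α < β)
    (x : EuclideanSpace ℝ (Fin d)) :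
    1 - gwPhi d β x = gwRatio d α β x * (1 - gwPhi d α x) := by
  by_cases h : 1 - gwPhi d α x = 0
  · have h1 : Real.exp (-‖x‖ ^ α) = 1 := by
      rw [gwPhi, sub_eq_zero] at h
      exact_mod_cast h.symm
    rw [Real.exp_eq_one_iff, neg_eq_zero, Real.rpow_eq_zero (norm_nonneg x) hα.ne'] at h1
    simp [gwPhi, h1, Real.zero_rpow hα.ne', Real.zero_rpow (hα.trans hαβ).ne']
  · rw [gwRatio, div_mul_cancel₀ _ h]

/-! ### The main theorem. -/

theorem mainTheorem2 (d : ℕ) (α β : ℝ) (hα : 0 < α) (hαβ : α < β) :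
    -- the quotient lies in the Wiener algebra with unit adjoined
    gwRatio d α β ∈ wienerOne d ∧
    -- the means are well defined and act in every `L_p`
    (∀ γ : ℝ, 0 < γ →
      Integrable (fourierHat (gwPhi d γ)) volume ∧
      ∀ p : ℝ≥0∞, 1 ≤ p → ∀ f : EuclideanSpace ℝ (Fin d) → ℂ, MemLp f p volume →
        ∀ ε : ℝ, 0 < ε →
          (∀ᵐ x, Integrable (fun y => fourierHat (gwPhi d γ) y * f (x - ε • y)) volume) ∧
          MemLp (gwMean γ ε f) p volume) ∧
    -- comparison of the approximation errors
    ∃ c : ℝ≥0, ∀ p : ℝ≥0∞, 1 ≤ p → ∀ f : EuclideanSpace ℝ (Fin d) → ℂ, MemLp f p volume →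
      ∀ ε : ℝ, 0 < ε →
        eLpNorm (fun x => f x - gwMean β ε f x) p volume ≤
          (c : ℝ≥0∞) * eLpNorm (fun x => f x - gwMean α ε f x) p volume := by
  have hψ := gwRatio_sub_one_mem_wienerZero d hα hαβ
  refine ⟨⟨1, _, hψ, fun x => by ring⟩, fun γ hγ => ⟨(fourierHat_gwPhi d hγ).1,
    fun p hp f hf ε hε => ⟨?_, ?_⟩⟩, ?_⟩
  · exact (ae_convolutionExistsAt_of_memLp (integrable_gwKernel d hγ hε) hp hf).mono
      fun x hx => integrable_fourierHat_gwPhi_mul hε hx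
  · rw [gwMean_eq_convolution γ hε]
    exact hf.convolution_of_integrable (integrable_gwKernel d hγ hε) hp
  · obtain ⟨g, hg, hgψ⟩ := hψ
    -- Replacing `ψ` by `ψ(ε ·)` dilates `g` without changing its `L¹` norm, so the constant does
    -- not depend on `ε`.
    have hnorm : ∀ ε : ℝ, 0 < ε → eLpNorm
        (fun x : EuclideanSpace ℝ (Fin d) => (((ε ^ d)⁻¹ : ℝ) : ℂ) * g (ε⁻¹ • x)) 1 volume =
          eLpNorm g 1 volume := by
      intro ε hε
      rw [eLpNorm_one_eq_lintegral_enorm, eLpNorm_one_eq_lintegral_enorm,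
        ← ofReal_integral_norm_eq_lintegral_enorm hg,
        ← ofReal_integral_norm_eq_lintegral_enorm (integrable_dilate hg hε),
        integral_norm_dilate g hε]
    have hgt : eLpNorm g 1 volume ≠ ⊤ := (memLp_one_iff_integrable.2 hg).2.ne
    refine ⟨1 + (eLpNorm g 1 volume).toNNReal, fun p hp f hf ε hε => ?_⟩
    rw [ENNReal.coe_add, ENNReal.coe_one, ENNReal.coe_toNNReal hgt, ← hnorm ε hε,
      gwMean_eq_convolution α hε, gwMean_eq_convolution β hε]
    refine eLpNorm_sub_convolution_le (integrable_gwKernel d hα hε)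
      (integrable_gwKernel d (hα.trans hαβ) hε) (integrable_dilate hg hε) (fun y => ?_) hp hf
    rw [fourierHat_gwKernel d (hα.trans hαβ) hε, fourierHat_gwKernel d hα hε,
      fourierHat_dilate g hε, ← congrFun hgψ (ε • y), one_sub_gwPhi_eq d hα hαβ]
    ring
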